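/- Conventions. A finite simplicial complex is a finite family $K$ of nonempty finite sets (the simplices) such that every nonempty subset of a simplex is a simplex; the vertices of $K$ are the elements of its simplices. Finite posets and finite simplicial complexes may be empty and are considered up to isomorphism. An element $x$ of a finite poset $P$ is *irreducible* if $P_{<x}=\{y\in P: y<x\}$ has a maximum or $P_{>x}=\{y\in P: y>x\}$ has a minimum. A finite poset is *dismantlable* if it can be written $\{x_1,\dots,x_n\}$ with $n\ge 1$ and the $x_i$ distinct, where $x_i$ is irreducible in the subposet $\{x_1,\dots,x_i\}$ for $2\le i\le n$. An element $x\in P$ is a *weak point* if $P_{<x}$ or $P_{>x}$ is dismantlable. Two finite posets are *simply equivalent* if one can be transformed into the other by a finite sequence of additions or deletions of weak points, all the intermediate posets being finite. An *elementary collapse* of a finite simplicial complex $K$ is the passage from $K$ to $K\setminus\{\sigma,\tau\}$, where $\sigma,\tau\in K$, $\tau$ is a maximal proper face of $\sigma$, and $\sigma$ and $\tau$ are the only simplices of $K$ that contain $\tau$. Two finite simplicial complexes have *the same simple-homotopy type* if one can be transformed into the other by a finite sequence of elementary collapses and inverses of elementary collapses, all the intermediate complexes being finite simplicial complexes. The *order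 complex* $\Delta_{\mathscr P}(P)$ of a finite poset $P$ is the simplicial complex whose simplices are the nonempty chains of $P$. The *face poset* $\Pi(K)$ of a finite simplicial complex $K$ is the set of its simplices ordered by inclusion. **Theorem.** 1. Let $P$ and $Q$ be finite posets. Then $P$ and $Q$ are simply equivalent if and only if $\Delta_{\mathscr P}(P)$ and $\Delta_{\mathscr P}(Q)$ have the same simple-homotopy type. 2. Let $K$ and $L$ be finite simplicial complexes. Then $K$ and $L$ have the same simple-homotopy type if and only if $\Pi(K)$ and $\Pi(L)$ are simply equivalent. -/

import Mathlib

universe u v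

/-! Finite posets: dismantlability, weak points and simple equivalence. -/

/-- `x` is irreducible in the subposet `s` (which is meant to contain `x`): the set of elements
of `s` strictly below `x` has a maximum, or the set of elements of `s` strictly above `x` has a
minimum. -/
def IsIrreducibleIn {α : Type u} [PartialOrder α] (s : Set α) (x : α) : Prop :=
  (∃ m, IsGreatest {y ∈ s | y < x} m) ∨ (∃ m, IsLeast {y ∈ s | x < y} m)

/-- The subposet `s` is dismantlable: `s = {x₁, …, xₙ}` with `n ≥ 1`, where for each
`2 ≤ i ≤ n` the element `xᵢ` is irreducible in the subposet `{x₁, …, xᵢ}`. In particular the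
empty subposet is not dismantlable. -/
inductive IsDismantlable {α : Type u} [PartialOrder α] : Set α → Prop
  | singleton (x : α) : IsDismantlable {x}
  | insert (s : Set α) (x : α) (hs : IsDismantlable s) (hx : x ∉ s)
      (hirr : IsIrreducibleIn (insert x s) x) : IsDismantlable (insert x s)

/-- `x` is a weak point: the subposet of the elements strictly below `x`, or that of the elements
strictly above `x`, is dismantlable. -/
def IsWeakPoint {α : Type u} [PartialOrder α] (x : α) : Prop :=
  IsDismantlable (Set.Iio x) ∨ IsDismantlable (Set.Ioi x)

/-- One step: `Q` is a copy of `P`, or a copy of `P` with one weak point of `P` deleted. -/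
def PosetStep (P Q : FinPartOrd.{u}) : Prop :=
  Nonempty (P ≃o Q) ∨ ∃ x : P, IsWeakPoint x ∧ Nonempty ({y : P // y ≠ x} ≃o Q)

/-- `P` can be transformed into `Q` (as usual, up to isomorphism) by a finite sequence of deletions
and additions of weak points. -/
def SimplyEquivalent (P Q : FinPartOrd.{u}) : Prop :=
  Relation.EqvGen PosetStep P Q

/-! Finite simplicial complexes: collapses and simple-homotopy type. The simplices are the nonempty
ones; the vertices of `K` are the elements `v` of the ambient type such that `{v}` is a simplex. -/

/-- A finite abstract simplicial complex. Elements of the type `V` that are not vertices of the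
complex play no role. -/
structure FinSimplicialComplex where
  V : Type u
  complex : PreAbstractSimplicialComplex V
  finite_faces : complex.faces.Finite

/-- The vertices of a simplicial complex. -/
def vertexSet {V : Type u} (K : PreAbstractSimplicialComplex V) : Set V :=
  {v | {v} ∈ K.faces}

/-- `K` and `L` are isomorphic simplicial complexes: there is a bijection between their vertices
under which simplices correspond to simplices. -/
def SimplicialIso {V W : Type u} (K : PreAbstractSimplicialComplex V)
    (L : PreAbstractSimplicialComplex W) : Prop :=
  ∃ e : vertexSet K ≃ vertexSet L, ∀ s : Finset (vertexSet K),
    s.map (Function.Embedding.subtype _) ∈ K.faces ↔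
      (s.map e.toEmbedding).map (Function.Embedding.subtype _) ∈ L.faces

/-- `L` is obtained from `K` by an elementary collapse: `L = K \ {σ, τ}`, where `τ` is a maximal
proper face of `σ` and is a face of no simplex other than `σ` and itself. -/
def ElementaryCollapse {V : Type u} (K L : PreAbstractSimplicialComplex V) : Prop :=
  ∃ σ ∈ K.faces, ∃ τ ∈ K.faces, τ ⋖ σ ∧
    (∀ ρ ∈ K.faces, τ ⊆ ρ → ρ = τ ∨ ρ = σ) ∧ L.faces = K.faces \ {σ, τ}

/-- One step: an isomorphism or an elementary collapse. -/
inductive ComplexStep : FinSimplicialComplex.{u} → FinSimplicialComplex.{u} → Prop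
  | iso (K L : FinSimplicialComplex.{u}) (h : SimplicialIso K.complex L.complex) :
      ComplexStep K L
  | collapse (V : Type u) (K L : PreAbstractSimplicialComplex V) (hK : K.faces.Finite)
      (hL : L.faces.Finite) (h : ElementaryCollapse K L) : ComplexStep ⟨V, K, hK⟩ ⟨V, L, hL⟩

/-- `K` can be transformed into `L` (as usual, up to isomorphism) by a finite sequence of
elementary collapses and elementary expansions, passing through finite simplicial complexes. -/
def SameSimpleHomotopyType (K L : FinSimplicialComplex.{u}) : Prop :=
  Relation.EqvGen ComplexStep K L

/-- The order complex of a finite poset: its simplices are the nonempty chains. -/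
def orderComplex (P : FinPartOrd.{u}) : FinSimplicialComplex.{u} where
  V := P
  complex :=
    { faces := {s | s.Nonempty ∧ IsChain (· ≤ ·) (s : Set P)}
      isRelLowerSet_faces := fun _ h =>
        ⟨h.1, fun _ hts ht => ⟨ht, h.2.mono (Finset.coe_subset.mpr hts)⟩⟩ }
  finite_faces := Set.toFinite _

/-- The face poset of a finite simplicial complex: its simplices, ordered by inclusion. -/
noncomputable def facePoset (K : FinSimplicialComplex.{u}) : FinPartOrd.{u} :=
  letI : Fintype {s : Finset K.V // s ∈ K.complex.faces} := K.finite_faces.fintype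
  FinPartOrd.of {s : Finset K.V // s ∈ K.complex.faces}

/-!
Both functors turn one elementary move into finitely many moves of the other kind, and their
composites are barycentric subdivisions, which do not change the equivalence class.

* *Weak points give collapses.* Let `x` be a weak point of `P`, and let `y` be the last point of
  the dismantlable set `P_{<x}` or `P_{>x}`, irreducible with witness `m`. The chains through `x`
  and `y` form an upward closed set of simplices that is stable under inserting and erasing `m`, so
  they can be collapsed away in pairs `c, c ∪ {m}` (`collapses_of_cone`). By induction the order
  complex of `P` collapses to that of `P \ {x}` (`collapses_chainsThrough`).
* *Collapses give weak points.* A free face `τ` of `σ` has only `σ` above it in the face poset.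
  Once it is deleted, the faces below `σ` form a conically contractible, hence dismantlable
  poset, so `σ` is a weak point (`ElementaryCollapse.simplyEquivalent`).
* *Subdivision of posets.* The map `max` from the poset of nonempty chains of `P` to `P` has
  dismantlable fibres over the sets `P_{≤y}`. For such a map all points of the source, and likewise
  all points of the target, can be deleted from the mapping cylinder as weak points
  (`simplyEquivalent_of_dismantlable_fibres`, `simplyEquivalent_facePoset_orderComplex`).
* *Subdivision of complexes.* The simplices `s ∪ {t₁ < ⋯ < tₖ}` with `s ⊆ t₁` form a complex that
  contains both `K` and its barycentric subdivision, and it collapses to either of them by removing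
  pieces that are cones (`collapses_of_patchwork`, `sameSimpleHomotopyType_orderComplex_facePoset`).
-/

/-! ### Dismantlable sets -/

section Dismantlable

variable {α : Type u} [PartialOrder α]

/-- Dismantlability is invariant under order embeddings. -/
theorem IsDismantlable.image {β : Type v} [PartialOrder β] (f : α ↪o β) {s : Set α}
    (hs : IsDismantlable s) : IsDismantlable (f '' s) := by
  induction hs with
  | singleton x => simpa using IsDismantlable.singleton (f x)
  | insert s x _ hx hirr ih =>
    rw [Set.image_insert_eq]
    refine .insert _ _ ih (by simpa using hx) ?_
    rcases hirr with ⟨m, ⟨hm, hmx⟩, hb⟩ | ⟨m, ⟨hm, hmx⟩, hb⟩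
    · refine .inl ⟨f m, ⟨?_, by simpa using hmx⟩, ?_⟩
      · rw [← Set.image_insert_eq]; exact Set.mem_image_of_mem f hm
      · rintro _ ⟨hy, hyx⟩
        rw [← Set.image_insert_eq] at hy
        obtain ⟨y, hy, rfl⟩ := hy
        exact f.le_iff_le.2 (hb ⟨hy, f.lt_iff_lt.1 hyx⟩)
    · refine .inr ⟨f m, ⟨?_, by simpa using hmx⟩, ?_⟩
      · rw [← Set.image_insert_eq]; exact Set.mem_image_of_mem f hm
      · rintro _ ⟨hy, hyx⟩
        rw [← Set.image_insert_eq] at hy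
        obtain ⟨y, hy, rfl⟩ := hy
        exact f.le_iff_le.2 (hb ⟨hy, f.lt_iff_lt.1 hyx⟩)

theorem IsDismantlable.preimage {β : Type v} [PartialOrder β] (f : β ↪o α) {s : Set α}
    (hs : IsDismantlable s) (hf : s ⊆ Set.range f) : IsDismantlable (f ⁻¹' s) := by
  induction hs with
  | singleton x =>
    obtain ⟨a, rfl⟩ := hf rfl
    have : f ⁻¹' {f a} = {a} := by ext; simp
    rw [this]
    exact .singleton a
  | insert s x _ hx hirr ih =>
    obtain ⟨a, rfl⟩ := hf (Set.mem_insert _ _)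
    have h : f ⁻¹' (Insert.insert (f a) s) = Insert.insert a (f ⁻¹' s) := by ext; simp
    rw [h]
    refine .insert _ _ (ih ((Set.subset_insert _ _).trans hf)) hx ?_
    rw [← h]
    rcases hirr with ⟨m, ⟨hm, hmx⟩, hb⟩ | ⟨m, ⟨hm, hmx⟩, hb⟩
    · obtain ⟨m, rfl⟩ := hf hm
      exact .inl ⟨m, ⟨hm, f.lt_iff_lt.1 hmx⟩,
        fun y hy => f.le_iff_le.1 (hb ⟨hy.1, f.lt_iff_lt.2 hy.2⟩)⟩
    · obtain ⟨m, rfl⟩ := hf hm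
      exact .inr ⟨m, ⟨hm, f.lt_iff_lt.1 hmx⟩,
        fun y hy => f.le_iff_le.1 (hb ⟨hy.1, f.lt_iff_lt.2 hy.2⟩)⟩

/-- The elements of `u` are removed from `t ∪ u` from the top downwards, so that when the turn of
`x ∈ u` comes, all remaining elements above `x` belong to `t`. -/
theorem IsDismantlable.union {t : Set α} (ht : IsDismantlable t) {u : Set α} (hu : u.Finite)
    (hd : Disjoint t u) (h : ∀ x ∈ u, ∃ m, IsLeast {y ∈ t | x < y} m) :
    IsDismantlable (t ∪ u) := by
  induction hn : u.ncard generalizing u with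
  | zero =>
    rw [Set.ncard_eq_zero hu] at hn
    simpa [hn] using ht
  | succ n ih =>
    have hne : u.Nonempty := Set.nonempty_of_ncard_ne_zero (by omega)
    obtain ⟨x, hx⟩ := hu.exists_maximal hne
    have hxt : x ∉ t := fun h => Set.disjoint_left.1 hd h hx.prop
    have key := ih (u := u \ {x}) hu.sdiff (hd.mono_right Set.sdiff_subset)
      (fun y hy => h y hy.1) (by rw [Set.ncard_sdiff_singleton_of_mem hx.prop]; omega)
    have e : t ∪ u = Insert.insert x (t ∪ u \ {x}) := by
      ext y
      have := hx.prop
      by_cases hy : y = x <;> simp_all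
    rw [e]
    refine .insert _ _ key (by simp [hxt]) (.inr ?_)
    obtain ⟨m, hm⟩ := h x hx.prop
    refine ⟨m, ?_⟩
    convert hm using 1
    ext y
    rw [← e]
    constructor
    · rintro ⟨hy | hy, hxy⟩
      · exact ⟨hy, hxy⟩
      · exact absurd hxy (hx.not_gt hy)
    · exact fun hy => ⟨.inl hy.1, hy.2⟩

theorem isDismantlable_of_isLeast {s : Set α} (hs : s.Finite) {c : α} (hc : IsLeast s c) :
    IsDismantlable s := by
  induction hn : (s \ {c}).ncard generalizing s with
  | zero =>
    rw [Set.ncard_eq_zero hs.sdiff] at hn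
    have : s = {c} := by
      refine Set.Subset.antisymm (Set.sdiff_eq_empty.1 hn) (by simpa using hc.1)
    rw [this]
    exact .singleton c
  | succ n ih =>
    have hne : (s \ {c}).Nonempty := Set.nonempty_of_ncard_ne_zero (by omega)
    obtain ⟨x, hx⟩ := (hs.sdiff (t := {c})).exists_minimal hne
    have hcx : c < x := lt_of_le_of_ne (hc.2 hx.prop.1) (Ne.symm hx.prop.2)
    have e : insert x (s \ {x}) = s := by simp [hx.prop.1]
    rw [← e]
    refine .insert _ _ (ih hs.sdiff ⟨⟨hc.1, hcx.ne⟩, fun y hy => hc.2 hy.1⟩ ?_) (by simp)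
      (.inl ⟨c, ⟨by rw [e]; exact hc.1, hcx⟩, ?_⟩)
    · rw [Set.sdiff_sdiff_comm, Set.ncard_sdiff_singleton_of_mem hx.prop]; omega
    · rw [e]
      rintro y ⟨hy, hyx⟩
      by_contra hyc
      exact hx.not_lt ⟨hy, fun h => hyc (le_of_eq h)⟩ hyx

/-- A conically contractible set `x ≤ f x ≥ c`, with `f` a closure operator, is dismantlable: the
elements that are not closed are removed from the top downwards, and `c` is the least of the
closed elements. -/
theorem isDismantlable_of_closure {s : Set α} (hs : s.Finite) (f : α → α) (c : α) (hc : c ∈ s)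
    (hfc : f c = c) (hfs : ∀ x ∈ s, f x ∈ s) (hle : ∀ x ∈ s, x ≤ f x) (hcf : ∀ x ∈ s, c ≤ f x)
    (hff : ∀ x ∈ s, f (f x) = f x) (hmono : ∀ x ∈ s, ∀ y ∈ s, x ≤ y → f x ≤ f y) :
    IsDismantlable s := by
  have h1 : IsDismantlable {x ∈ s | f x = x} :=
    isDismantlable_of_isLeast (hs.subset (Set.sep_subset _ _))
      ⟨⟨hc, hfc⟩, fun x hx => hx.2 ▸ hcf x hx.1⟩
  have h2 := h1.union (u := {x ∈ s | f x ≠ x}) (hs.subset (Set.sep_subset _ _))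
    (Set.disjoint_left.2 fun x hx hx' => hx'.2 hx.2)
    (fun x hx => ⟨f x, ⟨⟨hfs x hx.1, hff x hx.1⟩, lt_of_le_of_ne (hle x hx.1) (Ne.symm hx.2)⟩,
      fun y hy => hy.1.2 ▸ hmono x hx.1 y hy.1.1 hy.2.le⟩)
  convert h2 using 1
  ext x
  simp only [Set.mem_union, Set.mem_ofPred_eq]
  tauto

end Dismantlable

/-! ### Simple equivalence of subposets and mapping cylinders -/

theorem SimplyEquivalent.refl (P : FinPartOrd.{u}) : SimplyEquivalent P P :=
  Relation.EqvGen.refl P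

theorem SimplyEquivalent.symm {P Q : FinPartOrd.{u}} (h : SimplyEquivalent P Q) :
    SimplyEquivalent Q P :=
  Relation.EqvGen.symm _ _ h

theorem SimplyEquivalent.trans {P Q R : FinPartOrd.{u}} (h : SimplyEquivalent P Q)
    (h' : SimplyEquivalent Q R) : SimplyEquivalent P R :=
  Relation.EqvGen.trans _ _ _ h h'

theorem SimplyEquivalent.of_orderIso {P Q : FinPartOrd.{u}} (e : P ≃o Q) : SimplyEquivalent P Q :=
  Relation.EqvGen.rel _ _ (.inl ⟨e⟩)

section Subposet

variable {α : Type u} [PartialOrder α] [Finite α]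

/-- A subset of a finite poset as a finite poset. -/
noncomputable def subposet (s : Set α) : FinPartOrd.{u} :=
  letI : Fintype s := Fintype.ofFinite s
  FinPartOrd.of s

theorem simplyEquivalent_subposet_diff {s : Set α} {x : α} (hx : x ∈ s)
    (h : IsDismantlable {y ∈ s | y < x} ∨ IsDismantlable {y ∈ s | x < y}) :
    SimplyEquivalent (subposet s) (subposet (s \ {x})) := by
  refine Relation.EqvGen.rel _ _ (.inr ⟨(⟨x, hx⟩ : s), ?_, ⟨?_⟩⟩)
  · refine h.imp (fun h => ?_) (fun h => ?_)
    · change IsDismantlable (Set.Iio (⟨x, hx⟩ : s))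
      have := h.preimage (OrderEmbedding.subtype (· ∈ s)) (fun y hy => ⟨⟨y, hy.1⟩, rfl⟩)
      convert this using 1
      ext ⟨y, hy⟩
      exact ⟨fun h => ⟨hy, h⟩, fun h => h.2⟩
    · change IsDismantlable (Set.Ioi (⟨x, hx⟩ : s))
      have := h.preimage (OrderEmbedding.subtype (· ∈ s)) (fun y hy => ⟨⟨y, hy.1⟩, rfl⟩)
      convert this using 1
      ext ⟨y, hy⟩
      exact ⟨fun h => ⟨hy, h⟩, fun h => h.2⟩
  · exact
      { toFun := fun y => ⟨y.1.1, y.1.2, fun h => y.2 (Subtype.ext h)⟩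
        invFun := fun y => ⟨⟨y.1, y.2.1⟩, fun h => y.2.2 (congrArg Subtype.val h)⟩
        left_inv := fun _ => rfl
        right_inv := fun _ => rfl
        map_rel_iff' := Iff.rfl }

/-- Removal of all elements of `u`, one at a time. The relation `r` is to be `<` or `>`; elements of
`u` are removed in increasing order for `r`, so that an element loses all its `r`-predecessors in
`u` before it is removed itself. -/
theorem simplyEquivalent_subposet_compl (r : α → α → Prop) [IsStrictOrder α r]
    (hr : ∀ (s : Set α) (x : α), x ∈ s → IsDismantlable {y ∈ s | r y x} →
      SimplyEquivalent (subposet s) (subposet (s \ {x})))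
    (u : Set α) (h : ∀ x ∈ u, IsDismantlable {y | r y x ∧ y ∉ u}) :
    SimplyEquivalent (subposet (Set.univ : Set α)) (subposet uᶜ) := by
  induction hn : u.ncard generalizing u with
  | zero =>
    rw [Set.ncard_eq_zero] at hn
    rw [hn, Set.compl_empty]
    exact .refl _
  | succ n ih =>
    have hne : u.Nonempty := Set.nonempty_of_ncard_ne_zero (by omega)
    have wf : WellFounded (Function.swap r) := Finite.wellFounded_of_trans_of_irrefl _
    obtain ⟨x, hx, hmax⟩ := wf.has_min u hne
    have h1 := ih (u \ {x}) (fun z hz => ?_)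
      (by rw [Set.ncard_sdiff_singleton_of_mem hx]; omega)
    · have e : uᶜ = (u \ {x})ᶜ \ {x} := by
        ext y
        by_cases hy : y = x <;> simp_all
      rw [e]
      refine h1.trans (hr _ _ (by simp) ?_)
      convert h x hx using 1
      ext y
      have : r y x → y ≠ x := fun h e => irrefl_of r x (e ▸ h)
      simp only [Set.mem_ofPred_eq, Set.mem_compl_iff, Set.mem_sdiff, Set.mem_singleton_iff]
      tauto
    · convert h z hz.1 using 1
      ext y
      have : r y z → y ≠ x := fun h e => hmax z hz.1 (e ▸ h)
      simp only [Set.mem_ofPred_eq, Set.mem_sdiff, Set.mem_singleton_iff]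
      tauto

end Subposet

section MappingCylinder

variable {X Y : Type u} [PartialOrder X] [PartialOrder Y]

/-- The (non-Hausdorff) mapping cylinder of a monotone map `f : X → Y`: the disjoint union of `X`
and `Y`, where `x ∈ X` lies below `y ∈ Y` if and only if `f x ≤ y`. -/
inductive MappingCylinder (_f : X →o Y) : Type u
  | left (x : X)
  | right (y : Y)

namespace MappingCylinder

variable {f : X →o Y}

/-- The order relation of the mapping cylinder. -/
inductive Le : MappingCylinder f → MappingCylinder f → Prop
  | left {a b : X} (h : a ≤ b) : Le (.left a) (.left b)
  | cross {a : X} {y : Y} (h : f a ≤ y) : Le (.left a) (.right y)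
  | right {y z : Y} (h : y ≤ z) : Le (.right y) (.right z)

instance : PartialOrder (MappingCylinder f) where
  le := Le
  le_refl a := by cases a <;> constructor <;> exact le_rfl
  le_trans a b c hab hbc := by
    cases hab with
    | left h =>
      cases hbc with
      | left h' => exact .left (h.trans h')
      | cross h' => exact .cross ((f.monotone h).trans h')
    | cross h =>
      cases hbc with
      | right h' => exact .cross (h.trans h')
    | right h =>
      cases hbc with
      | right h' => exact .right (h.trans h')
  le_antisymm a b hab hba := by
    cases hab with
    | left h =>
      cases hba with
      | left h' => rw [le_antisymm h h']
    | cross h => cases hba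
    | right h =>
      cases hba with
      | right h' => rw [le_antisymm h h']

@[simp] theorem left_le_left {a b : X} :
    (left a : MappingCylinder f) ≤ left b ↔ a ≤ b :=
  ⟨fun h => by cases h; assumption, .left⟩

@[simp] theorem left_le_right {a : X} {y : Y} :
    (left a : MappingCylinder f) ≤ right y ↔ f a ≤ y :=
  ⟨fun h => by cases h; assumption, .cross⟩

@[simp] theorem right_le_right {y z : Y} :
    (right y : MappingCylinder f) ≤ right z ↔ y ≤ z :=
  ⟨fun h => by cases h; assumption, .right⟩

@[simp] theorem not_right_le_left {a : X} {y : Y} :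
    ¬ (right y : MappingCylinder f) ≤ left a :=
  fun h => by cases h

theorem left_lt_right {a : X} {y : Y} :
    (left a : MappingCylinder f) < right y ↔ f a ≤ y := by
  simp [lt_iff_le_not_ge]

/-- The inclusion of the source into the mapping cylinder. -/
def leftEmbedding (f : X →o Y) : X ↪o MappingCylinder f :=
  OrderEmbedding.ofMapLEIff left fun _ _ => left_le_left

/-- The inclusion of the target into the mapping cylinder. -/
def rightEmbedding (f : X →o Y) : Y ↪o MappingCylinder f :=
  OrderEmbedding.ofMapLEIff right fun _ _ => right_le_right

theorem compl_range_left :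
    (Set.range (left : X → MappingCylinder f))ᶜ = Set.range (rightEmbedding f) := by
  ext (a | y) <;> simp [rightEmbedding]

theorem compl_range_right :
    (Set.range (right : Y → MappingCylinder f))ᶜ = Set.range (leftEmbedding f) := by
  ext (a | y) <;> simp [leftEmbedding]

instance [Finite X] [Finite Y] : Finite (MappingCylinder f) :=
  Finite.of_surjective (Sum.elim left right : X ⊕ Y → MappingCylinder f) (by
    rintro (a | y)
    · exact ⟨.inl a, rfl⟩
    · exact ⟨.inr y, rfl⟩)

end MappingCylinder

open MappingCylinder in
/-- A poset analogue of Quillen's Theorem A: a monotone map whose fibres over the principal lower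
sets are dismantlable is a simple equivalence. In the mapping cylinder of `f`, all elements of the
source and all elements of the target can be deleted as weak points. -/
theorem simplyEquivalent_of_dismantlable_fibres {P Q : FinPartOrd.{u}} (f : P →o Q)
    (hf : ∀ y, IsDismantlable (f ⁻¹' Set.Iic y)) : SimplyEquivalent P Q := by
  have hP : SimplyEquivalent (subposet (Set.univ : Set (MappingCylinder f)))
      (subposet (Set.range (right : Q → MappingCylinder f))ᶜ) := by
    refine simplyEquivalent_subposet_compl (· < ·)
      (fun s x hx h => simplyEquivalent_subposet_diff hx (.inl h)) _ ?_
    rintro _ ⟨y, rfl⟩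
    convert (hf y).image (leftEmbedding f) using 1
    ext (a | z) <;> simp [leftEmbedding, left_lt_right]
  have hQ : SimplyEquivalent (subposet (Set.univ : Set (MappingCylinder f)))
      (subposet (Set.range (left : P → MappingCylinder f))ᶜ) := by
    refine simplyEquivalent_subposet_compl (· > ·)
      (fun s x hx h => simplyEquivalent_subposet_diff hx (.inr h)) _ ?_
    rintro _ ⟨a, rfl⟩
    refine isDismantlable_of_isLeast (Set.toFinite _) (c := right (f a))
      ⟨⟨left_lt_right.2 le_rfl, by simp⟩, ?_⟩
    rintro (b | y) ⟨h, h'⟩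
    · simp at h'
    · exact right_le_right.2 (left_lt_right.1 h)
  rw [compl_range_right] at hP
  rw [compl_range_left] at hQ
  exact (SimplyEquivalent.of_orderIso (Q := subposet _) (leftEmbedding f).orderIso).trans
    (hP.symm.trans (hQ.trans
      (SimplyEquivalent.of_orderIso (P := subposet _) (rightEmbedding f).orderIso.symm)))

end MappingCylinder

/-! ### Face posets -/

/-- The barycentric subdivision of a finite poset is simply equivalent to it, by the map that sends
a chain to its maximum: the fibre over `Set.Iic y` is contracted by `c ⊆ insert y c ⊇ {y}`. -/
theorem simplyEquivalent_facePoset_orderComplex (P : FinPartOrd.{u}) :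
    SimplyEquivalent (facePoset (orderComplex P)) P := by
  classical
  let C := {s : Finset P // s.Nonempty ∧ IsChain (· ≤ ·) (s : Set P)}
  let _ : Fintype C := Fintype.ofFinite C
  have hmax (c : C) : ∃ m, IsGreatest (c.1 : Set P) m := by
    obtain ⟨m, hm⟩ := c.1.exists_maximal c.2.1
    refine ⟨m, hm.prop, fun y hy => ?_⟩
    rcases c.2.2.total hy hm.prop with h | h
    · exact h
    · exact hm.le_of_ge hy h
  choose g hg using hmax
  let f : FinPartOrd.of C →o P := ⟨g, fun c d h => (hg d).2 (h (hg c).1)⟩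
  have hf (c : C) (y : P) : f c ≤ y ↔ ∀ z ∈ c.1, z ≤ y :=
    ⟨fun h z hz => ((hg c).2 hz).trans h, fun h => h _ (hg c).1⟩
  refine (SimplyEquivalent.of_orderIso (Q := FinPartOrd.of C) (OrderIso.refl C)).trans
    (simplyEquivalent_of_dismantlable_fibres f fun y => ?_)
  have hins (c : C) (h : ∀ z ∈ c.1, z ≤ y) : IsChain (· ≤ ·) (insert y c.1 : Set P) :=
    c.2.2.insert fun z hz _ => .inr (h z hz)
  -- Outside the fibre the value of the closure operator is irrelevant.
  let cl : C → C := fun c =>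
    if h : ∀ z ∈ c.1, z ≤ y then
      ⟨insert y c.1, Finset.insert_nonempty _ _, by simpa using hins c h⟩
    else c
  have hcl {c : C} (h : f c ≤ y) : (cl c).1 = insert y c.1 := by
    simp only [cl, dif_pos ((hf c y).1 h)]
  have hcl' {c : C} (h : f c ≤ y) : f (cl c) ≤ y := by
    rw [hf, hcl h]
    intro z hz
    rcases Finset.mem_insert.1 hz with rfl | hz
    · exact le_rfl
    · exact (hf c y).1 h z hz
  let c₀ : C := ⟨{y}, by simp, by simp⟩
  have hy : f c₀ ≤ y := (hf c₀ y).2 fun z hz => (Finset.mem_singleton.1 hz).le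
  refine isDismantlable_of_closure (Set.toFinite _) cl c₀ hy
    (Subtype.ext ?_) (fun c hc => hcl' hc) (fun c hc => ?_) (fun c hc => ?_)
    (fun c hc => Subtype.ext ?_) (fun c hc d hd h => ?_)
  · rw [hcl hy]; simp [c₀]
  · change c.1 ⊆ (cl c).1
    rw [hcl hc]; exact Finset.subset_insert _ _
  · change {y} ⊆ (cl c).1
    rw [hcl hc]; simp
  · rw [hcl (hcl' hc), hcl hc, Finset.insert_idem]
  · change (cl c).1 ⊆ (cl d).1
    rw [hcl hc, hcl hd]
    exact Finset.insert_subset_insert _ h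

/-- For an elementary collapse that removes `τ ⋖ σ`, the free face `τ` has only `σ` above it in the
face poset; once `τ` is deleted, the faces `s` below `σ` are contracted by `s ⊆ insert a s ⊇ {a}`,
where `a` is the vertex of `σ` opposite to `τ`. -/
theorem ElementaryCollapse.simplyEquivalent {V : Type u} {K L : PreAbstractSimplicialComplex V}
    (hK : K.faces.Finite) (hL : L.faces.Finite) (h : ElementaryCollapse K L) :
    SimplyEquivalent (facePoset ⟨V, K, hK⟩) (facePoset ⟨V, L, hL⟩) := by
  classical
  obtain ⟨σ, hσ, τ, hτ, hcov, hfree, hLK⟩ := h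
  let α := {s : Finset V // s ∈ K.faces}
  have : Finite α := hK.to_subtype
  obtain ⟨a, ha, rfl⟩ := Finset.covBy_iff_exists_insert.1 hcov
  let σ' : α := ⟨insert a τ, hσ⟩
  let τ' : α := ⟨τ, hτ⟩
  have hne : σ' ≠ τ' := fun h => hcov.lt.ne (congrArg Subtype.val h).symm
  have h0 : SimplyEquivalent (facePoset ⟨V, K, hK⟩) (subposet (Set.univ : Set α)) :=
    .of_orderIso (Q := subposet _) (OrderIso.Set.univ (α := α)).symm
  have h1 : SimplyEquivalent (subposet (Set.univ : Set α)) (subposet (Set.univ \ {τ'})) := by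
    refine simplyEquivalent_subposet_diff (Set.mem_univ _) (.inr ?_)
    convert IsDismantlable.singleton σ' using 1
    ext ρ
    simp only [Set.mem_univ, true_and, Set.mem_ofPred_eq, Set.mem_singleton_iff]
    constructor
    · intro hρ
      rcases hfree ρ.1 ρ.2 hρ.le with h | h
      · exact absurd (Subtype.ext h) hρ.ne'
      · exact Subtype.ext h
    · rintro rfl
      exact hcov.lt
  have h2 : SimplyEquivalent (subposet (Set.univ \ {τ'}))
      (subposet ((Set.univ \ {τ'}) \ {σ'})) := by
    refine simplyEquivalent_subposet_diff ⟨Set.mem_univ _, hne⟩ (.inl ?_)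
    have hmem {s : α} (hs : s ∈ {y ∈ Set.univ \ {τ'} | y < σ'}) :
        insert a s.1 ⊂ insert a τ := by
      obtain ⟨⟨-, hsτ⟩, hlt⟩ := hs
      have hlt : s.1 ⊂ insert a τ := hlt
      refine Finset.ssubset_iff_subset_ne.2
        ⟨Finset.insert_subset (Finset.mem_insert_self _ _) hlt.subset, fun he => ?_⟩
      by_cases has : a ∈ s.1
      · rw [Finset.insert_eq_of_mem has] at he
        exact hlt.ne he
      · exact hsτ (Subtype.ext (by
          rw [← Finset.erase_insert has, he, Finset.erase_insert ha]))
    have hface {t : Finset V} (ht : a ∈ t) (hts : t ⊆ insert a τ) : t ∈ K.faces :=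
      (K.isRelLowerSet_faces hσ).2 hts ⟨a, ht⟩
    let cl : α → α := fun s => if h : insert a s.1 ∈ K.faces then ⟨insert a s.1, h⟩ else s
    have hcl {s : α} (hs : s ∈ {y ∈ Set.univ \ {τ'} | y < σ'}) : (cl s).1 = insert a s.1 := by
      simp only [cl, dif_pos (hface (Finset.mem_insert_self a _) (hmem hs).subset)]
    have hcl' {s : α} (hs : s ∈ {y ∈ Set.univ \ {τ'} | y < σ'}) :
        cl s ∈ {y ∈ Set.univ \ {τ'} | y < σ'} := by
      refine ⟨⟨Set.mem_univ _, fun h => ha ?_⟩, ?_⟩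
      · have h : (cl s).1 = τ := congrArg Subtype.val h
        rw [← h, hcl hs]; exact Finset.mem_insert_self _ _
      · change (cl s).1 ⊂ insert a τ
        rw [hcl hs]; exact hmem hs
    have hvert : {a} ∈ K.faces := hface (Finset.mem_singleton_self a) (by simp)
    have hv : (⟨{a}, hvert⟩ : α) ∈ {y ∈ Set.univ \ {τ'} | y < σ'} := by
      refine ⟨⟨Set.mem_univ _, fun h => ha ?_⟩, ?_⟩
      · have h : {a} = τ := congrArg Subtype.val h
        rw [← h]; exact Finset.mem_singleton_self _
      · have hτne : τ.Nonempty := (K.isRelLowerSet_faces hτ).1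
        change {a} ⊂ insert a τ
        refine Finset.ssubset_iff_subset_ne.2 ⟨by simp, fun h => ?_⟩
        obtain ⟨b, hb⟩ := hτne
        have : b ∈ ({a} : Finset V) := h ▸ Finset.mem_insert_of_mem hb
        exact ha (Finset.mem_singleton.1 this ▸ hb)
    refine isDismantlable_of_closure (Set.toFinite _) cl ⟨{a}, hvert⟩ hv (Subtype.ext ?_)
      (fun c hc => hcl' hc) (fun c hc => ?_) (fun c hc => ?_)
      (fun c hc => Subtype.ext ?_) (fun c hc d hd h => ?_)
    · rw [hcl hv]; simp
    · change c.1 ⊆ (cl c).1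
      rw [hcl hc]; exact Finset.subset_insert _ _
    · change {a} ⊆ (cl c).1
      rw [hcl hc]; simp
    · rw [hcl (hcl' hc), hcl hc, Finset.insert_idem]
    · change (cl c).1 ⊆ (cl d).1
      rw [hcl hc, hcl hd]
      exact Finset.insert_subset_insert _ h
  have hmemL (s : Finset V) : s ∈ L.faces ↔ s ∈ K.faces ∧ s ≠ τ ∧ s ≠ insert a τ := by
    rw [hLK]
    simp only [Set.mem_sdiff, Set.mem_insert_iff, Set.mem_singleton_iff]
    tauto
  refine h0.trans (h1.trans (h2.trans (.of_orderIso (P := subposet _) ?_)))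
  exact
    { toFun := fun s => ⟨s.1.1, (hmemL _).2 ⟨s.1.2,
        fun h => s.2.1.2 (Subtype.ext h), fun h => s.2.2 (Subtype.ext h)⟩⟩
      invFun := fun s => ⟨⟨s.1, ((hmemL _).1 s.2).1⟩, ⟨Set.mem_univ _,
        fun h => ((hmemL _).1 s.2).2.1 (congrArg Subtype.val h)⟩,
        fun h => ((hmemL _).1 s.2).2.2 (congrArg Subtype.val h)⟩
      left_inv := fun _ => rfl
      right_inv := fun _ => rfl
      map_rel_iff' := Iff.rfl }

/-! ### Isomorphisms of simplicial complexes -/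

theorem SameSimpleHomotopyType.symm {K L : FinSimplicialComplex.{u}}
    (h : SameSimpleHomotopyType K L) : SameSimpleHomotopyType L K :=
  Relation.EqvGen.symm _ _ h

theorem SameSimpleHomotopyType.trans {K L M : FinSimplicialComplex.{u}}
    (h : SameSimpleHomotopyType K L) (h' : SameSimpleHomotopyType L M) :
    SameSimpleHomotopyType K M :=
  Relation.EqvGen.trans _ _ _ h h'

/-- A complex is isomorphic to its image under an injection of the ambient vertex types. -/
theorem simplicialIso_of_embedding {V W : Type u} {K : PreAbstractSimplicialComplex V}
    {L : PreAbstractSimplicialComplex W} (f : V ↪ W)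
    (h : ∀ t, t ∈ L.faces ↔ ∃ s ∈ K.faces, s.map f = t) : SimplicialIso K L := by
  have hv (v : V) (hv : v ∈ vertexSet K) : f v ∈ vertexSet L := (h _).2 ⟨{v}, hv, by simp⟩
  let g : vertexSet K → vertexSet L := fun v => ⟨f v.1, hv v.1 v.2⟩
  have hg : Function.Bijective g := by
    refine ⟨fun a b hab => Subtype.ext (f.injective (congrArg Subtype.val hab)), fun w => ?_⟩
    obtain ⟨s, hs, hsw⟩ := (h _).1 w.2
    obtain ⟨v, hvs, hvw⟩ := Finset.mem_map.1 (hsw ▸ Finset.mem_singleton_self w.1)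
    have : s = {v} := by
      apply Finset.map_injective f
      rw [hsw, Finset.map_singleton, hvw]
    subst this
    exact ⟨⟨v, hs⟩, Subtype.ext hvw⟩
  refine ⟨Equiv.ofBijective g hg, fun s => ?_⟩
  have e : (s.map (Equiv.ofBijective g hg).toEmbedding).map (Function.Embedding.subtype _) =
      (s.map (Function.Embedding.subtype _)).map f := by
    simp only [Finset.map_map]
    rfl
  rw [e, h]
  exact ⟨fun hs => ⟨_, hs, rfl⟩, fun ⟨t, ht, hts⟩ => Finset.map_injective f hts ▸ ht⟩

/-- The faces of a complex, as sets of elements of its vertex set. -/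
noncomputable def facesOnVertices {V : Type u} (K : PreAbstractSimplicialComplex V) :
    {s : Finset (vertexSet K) // s.map (Function.Embedding.subtype _) ∈ K.faces} ≃o
      {s : Finset V // s ∈ K.faces} :=
  RelIso.ofSurjective
    (OrderEmbedding.ofMapLEIff (fun s => ⟨s.1.map (Function.Embedding.subtype _), s.2⟩)
      fun _ _ => Finset.map_subset_map)
    (by
      classical
      rintro ⟨s, hs⟩
      have e : (s.subtype (· ∈ vertexSet K)).map (Function.Embedding.subtype _) = s :=
        Finset.subtype_map_of_mem fun v hv =>
          (K.isRelLowerSet_faces hs).2 (Finset.singleton_subset_iff.2 hv)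
            (Finset.singleton_nonempty v)
      exact ⟨⟨s.subtype (· ∈ vertexSet K), by rw [e]; exact hs⟩, Subtype.ext e⟩)

theorem SimplicialIso.simplyEquivalent {K L : FinSimplicialComplex.{u}}
    (h : SimplicialIso K.complex L.complex) : SimplyEquivalent (facePoset K) (facePoset L) := by
  obtain ⟨e, he⟩ := h
  let φ : {s : Finset (vertexSet K.complex) //
        s.map (Function.Embedding.subtype _) ∈ K.complex.faces} ≃o
      {s : Finset (vertexSet L.complex) //
        s.map (Function.Embedding.subtype _) ∈ L.complex.faces} :=
    { toEquiv := (Equiv.finsetCongr e).subtypeEquiv he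
      map_rel_iff' := Finset.map_subset_map }
  exact .of_orderIso ((facesOnVertices K.complex).symm.trans
    (φ.trans (facesOnVertices L.complex)))

/-- The complex of nonempty chains of a poset. -/
def chainComplex (α : Type u) [PartialOrder α] : PreAbstractSimplicialComplex α where
  faces := {s | s.Nonempty ∧ IsChain (· ≤ ·) (s : Set α)}
  isRelLowerSet_faces := fun _ h =>
    ⟨h.1, fun _ hts ht => ⟨ht, h.2.mono (Finset.coe_subset.2 hts)⟩⟩

/-- The chain complex of a subposet consists of the chains that lie in the subposet. -/
theorem simplicialIso_chainComplex {α β : Type u} [PartialOrder α] [PartialOrder β] (f : β ↪o α)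
    {L : PreAbstractSimplicialComplex α}
    (hL : ∀ t, t ∈ L.faces ↔
      t.Nonempty ∧ IsChain (· ≤ ·) (t : Set α) ∧ ∀ y ∈ t, y ∈ Set.range f) :
    SimplicialIso (chainComplex β) L := by
  refine simplicialIso_of_embedding f.toEmbedding fun t => ?_
  rw [hL]
  constructor
  · rintro ⟨⟨y, hy⟩, hc, ht⟩
    refine ⟨t.preimage f f.injective.injOn, ⟨?_, fun a ha b hb _ => ?_⟩, ?_⟩
    · obtain ⟨z, rfl⟩ := ht y hy
      exact ⟨z, Finset.mem_preimage.2 hy⟩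
    · simpa using hc.total (Finset.mem_preimage.1 ha) (Finset.mem_preimage.1 hb)
    · ext y
      constructor
      · intro hy
        obtain ⟨z, hz, rfl⟩ := Finset.mem_map.1 hy
        exact Finset.mem_preimage.1 hz
      · intro hy
        obtain ⟨z, rfl⟩ := ht y hy
        exact Finset.mem_map.2 ⟨z, Finset.mem_preimage.2 hy, rfl⟩
  · rintro ⟨s, ⟨hne, hc⟩, rfl⟩
    refine ⟨hne.map, fun a ha b hb _ => ?_, fun y hy => ?_⟩
    · obtain ⟨a, ha', rfl⟩ := Finset.mem_map.1 ha
      obtain ⟨b, hb', rfl⟩ := Finset.mem_map.1 hb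
      simpa using hc.total ha' hb'
    · obtain ⟨z, -, rfl⟩ := Finset.mem_map.1 hy
      exact ⟨z, rfl⟩

theorem SameSimpleHomotopyType.of_orderIso {P Q : FinPartOrd.{u}} (e : P ≃o Q) :
    SameSimpleHomotopyType (orderComplex P) (orderComplex Q) :=
  Relation.EqvGen.rel _ _ (.iso _ _ (simplicialIso_chainComplex (L := chainComplex Q)
    e.toOrderEmbedding fun _ => and_congr_right fun _ => (and_iff_left
      fun y _ => e.surjective y).symm))

/-! ### Collapses along cones -/

section Collapse

variable {V : Type u}

/-- The subcomplex obtained by removing a set of faces that is closed under passing to larger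
faces. -/
def removeFaces (K : PreAbstractSimplicialComplex V) (A : Set (Finset V))
    (hA : ∀ c ∈ A, ∀ d ∈ K.faces, c ⊆ d → d ∈ A) : PreAbstractSimplicialComplex V where
  faces := K.faces \ A
  isRelLowerSet_faces := fun _ h => ⟨(K.isRelLowerSet_faces h.1).1, fun _ hts ht =>
    ⟨(K.isRelLowerSet_faces h.1).2 hts ht, fun htA => h.2 (hA _ htA _ h.1 hts)⟩⟩

/-- If `A` is an upward closed set of faces that is stable under inserting and erasing the vertex
`m`, then `K` collapses to `K \ A`: the pairs `c, insert m c` with `m ∉ c` are removed in order of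
decreasing `c`. -/
theorem collapses_of_cone [DecidableEq V] {K L : PreAbstractSimplicialComplex V}
    (hK : K.faces.Finite) (m : V) {A : Set (Finset V)} (hA : A ⊆ K.faces)
    (hup : ∀ c ∈ A, ∀ d ∈ K.faces, c ⊆ d → d ∈ A)
    (hcone : ∀ c ∈ A, insert m c ∈ A ∧ c.erase m ∈ A) (hL : L.faces = K.faces \ A) :
    Relation.ReflTransGen ElementaryCollapse K L := by
  induction hn : A.ncard using Nat.strong_induction_on generalizing K A with
  | _ n ih =>
    rcases A.eq_empty_or_nonempty with rfl | ⟨c, hc⟩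
    · have : K = L := PreAbstractSimplicialComplex.ext (by simp [hL])
      rw [this]
    · have hfin : {c ∈ A | m ∉ c}.Finite := hK.subset fun c hc => hA hc.1
      obtain ⟨c, ⟨hcA, hmc⟩, hmax⟩ := hfin.exists_maximal
        ⟨c.erase m, (hcone c hc).2, Finset.notMem_erase m c⟩
      -- By maximality of `c`, erasing `m` from a face that contains `c` gives back `c`.
      have hstar {d : Finset V} (hd : d ∈ K.faces) (hcd : c ⊆ d) : d = c ∨ d = insert m c := by
        have h1 : d.erase m = c := by
          refine Finset.Subset.antisymm (hmax ⟨(hcone d (hup c hcA d hd hcd)).2,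
            Finset.notMem_erase m d⟩ ?_) ?_ <;> exact Finset.subset_erase.2 ⟨hcd, hmc⟩
        by_cases hmd : m ∈ d
        · right; rw [← h1, Finset.insert_erase hmd]
        · left; rw [← h1, Finset.erase_eq_of_notMem hmd]
      have hup' : ∀ b ∈ ({insert m c, c} : Set (Finset V)), ∀ d ∈ K.faces, b ⊆ d →
          d ∈ ({insert m c, c} : Set (Finset V)) := by
        intro b hb d hd hbd
        have hcb : c ⊆ b := by
          rcases hb with rfl | rfl
          · exact Finset.subset_insert _ _
          · exact Finset.Subset.refl _
        exact (hstar hd (hcb.trans hbd)).symm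
      refine Relation.ReflTransGen.head (b := removeFaces K _ hup')
        ⟨insert m c, hA (hcone c hcA).1, c, hA hcA, Finset.covBy_insert hmc,
          fun d hd hcd => hstar hd hcd, rfl⟩ ?_
      refine ih (A \ {insert m c, c}).ncard ?_ (K := removeFaces K _ hup')
        (A := A \ {insert m c, c}) (hK.subset Set.sdiff_subset)
        (fun d hd => ⟨hA hd.1, hd.2⟩) (fun b hb d hd hbd => ⟨hup b hb.1 d hd.1 hbd, hd.2⟩)
        (fun d hd => ?_) ?_ rfl
      · rw [← hn]
        exact Set.ncard_lt_ncard ⟨Set.sdiff_subset, fun h => (h hcA).2 (by simp)⟩ (hK.subset hA)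
      · obtain ⟨hdA, hd⟩ := hd
        have hd1 : d ≠ insert m c := fun h => hd (.inl h)
        have hd2 : d ≠ c := fun h => hd (.inr h)
        refine ⟨⟨(hcone d hdA).1, ?_⟩, ⟨(hcone d hdA).2, ?_⟩⟩
        · rintro (h | h)
          · by_cases hmd : m ∈ d
            · exact hd1 (by rw [← h, Finset.insert_eq_of_mem hmd])
            · exact hd2 (by rw [← Finset.erase_insert hmd, h, Finset.erase_insert hmc])
          · exact hmc (h ▸ Finset.mem_insert_self m d)
        · rintro (h | h)
          · exact Finset.notMem_erase m d (h ▸ Finset.mem_insert_self m c)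
          · by_cases hmd : m ∈ d
            · exact hd1 (by rw [← h, Finset.insert_erase hmd])
            · exact hd2 (by rw [← h, Finset.erase_eq_of_notMem hmd])
      · rw [hL]
        have : ({insert m c, c} : Set (Finset V)) ⊆ A := by
          rintro _ (rfl | rfl)
          · exact (hcone c hcA).1
          · exact hcA
        ext d
        have := @this d
        simp only [removeFaces, Set.mem_sdiff]
        tauto

/-- The patchwork principle: pieces `A i`, each stable under inserting and erasing a vertex `m i`,
are removed one after the other in decreasing order of `i`. -/
theorem collapses_of_patchwork [DecidableEq V] {ι : Type v} [PartialOrder ι] [Finite ι]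
    {K L : PreAbstractSimplicialComplex V} (hK : K.faces.Finite) (A : ι → Set (Finset V))
    (m : ι → V) (hA : ∀ i, A i ⊆ K.faces) (hdisj : ∀ i j c, c ∈ A i → c ∈ A j → i = j)
    (hup : ∀ i, ∀ c ∈ A i, ∀ d ∈ K.faces, c ⊆ d → ∃ j, i ≤ j ∧ d ∈ A j)
    (hcone : ∀ i, ∀ c ∈ A i, insert (m i) c ∈ A i ∧ c.erase (m i) ∈ A i)
    (hL : L.faces = K.faces \ ⋃ i, A i) :
    Relation.ReflTransGen ElementaryCollapse K L := by
  have key (n : ℕ) : ∀ J : Set ι, IsUpperSet J → J.ncard = n →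
      ∀ M : PreAbstractSimplicialComplex V, M.faces = K.faces \ (⋃ i ∈ J, A i) →
        Relation.ReflTransGen ElementaryCollapse K M := by
    induction n with
    | zero =>
      intro J _ hn M hM
      rw [Set.ncard_eq_zero] at hn
      have : K = M := PreAbstractSimplicialComplex.ext (by simp [hM, hn])
      rw [this]
    | succ n ih =>
      intro J hJ hn M hM
      obtain ⟨i, hi⟩ := (Set.toFinite J).exists_minimal
        (Set.nonempty_of_ncard_ne_zero (by omega))
      have hJ' : IsUpperSet (J \ {i}) := by
        intro a b hab ha
        refine ⟨hJ hab ha.1, ?_⟩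
        intro hb
        obtain rfl : b = i := hb
        exact ha.2 (le_antisymm hab (hi.le_of_le ha.1 hab))
      have hup' : ∀ c ∈ ⋃ j ∈ J \ {i}, A j, ∀ d ∈ K.faces, c ⊆ d →
          d ∈ ⋃ j ∈ J \ {i}, A j := by
        intro c hc d hd hcd
        simp only [Set.mem_iUnion] at hc ⊢
        obtain ⟨j, hj, hcj⟩ := hc
        obtain ⟨k, hjk, hk⟩ := hup j c hcj d hd hcd
        exact ⟨k, hJ' hjk hj, hk⟩
      refine (ih (J \ {i}) hJ' (by rw [Set.ncard_sdiff_singleton_of_mem hi.prop]; omega)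
        (removeFaces K _ hup') rfl).trans ?_
      refine collapses_of_cone (hK.subset Set.sdiff_subset) (m i) (A := A i) (fun c hc => ?_)
        (fun c hc d hd hcd => ?_) (hcone i) ?_
      · refine ⟨hA i hc, fun h => ?_⟩
        simp only [Set.mem_iUnion] at h
        obtain ⟨j, hj, hcj⟩ := h
        exact hj.2 (hdisj j i c hcj hc)
      · obtain ⟨j, hij, hdj⟩ := hup i c hc d hd.1 hcd
        by_cases hji : j = i
        · exact hji ▸ hdj
        · exact absurd (Set.mem_biUnion (show j ∈ J \ {i} from ⟨hJ hij hi.prop, hji⟩) hdj) hd.2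
      · rw [hM]
        simp only [removeFaces]
        rw [Set.sdiff_sdiff, Set.union_comm, ← Set.biUnion_insert, Set.insert_sdiff_singleton,
          Set.insert_eq_of_mem hi.prop]
  exact key _ Set.univ isUpperSet_univ rfl L (by simpa using hL)

theorem ElementaryCollapse.finite {K L : PreAbstractSimplicialComplex V}
    (h : ElementaryCollapse K L) (hK : K.faces.Finite) : L.faces.Finite := by
  obtain ⟨σ, -, τ, -, -, -, h⟩ := h
  rw [h]
  exact hK.sdiff

theorem sameSimpleHomotopyType_of_collapses {K L : PreAbstractSimplicialComplex V}
    (h : Relation.ReflTransGen ElementaryCollapse K L) (hK : K.faces.Finite)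
    (hL : L.faces.Finite) : SameSimpleHomotopyType ⟨V, K, hK⟩ ⟨V, L, hL⟩ := by
  induction h using Relation.ReflTransGen.head_induction_on with
  | refl => exact Relation.EqvGen.refl _
  | head h _ ih =>
    exact (Relation.EqvGen.rel _ _ (.collapse V _ _ hK (h.finite hK) h)).trans _ _ _
      (ih (h.finite hK))

end Collapse

/-! ### Weak points and the order complex -/

section WeakPoint

variable {α : Type u} [PartialOrder α]

/-- The chains of a poset which, if they contain `x`, meet `B` only in elements of `s`. -/
def chainsThrough (x : α) (B s : Set α) : PreAbstractSimplicialComplex α where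
  faces := {c | c.Nonempty ∧ IsChain (· ≤ ·) (c : Set α) ∧ (x ∈ c → ∀ y ∈ c, y ∈ B → y ∈ s)}
  isRelLowerSet_faces := fun _ h => ⟨h.1, fun _ hts ht =>
    ⟨ht, h.2.1.mono (Finset.coe_subset.2 hts), fun hx y hy => h.2.2 (hts hx) y (hts hy)⟩⟩

/-- The chains of a poset that do not contain `x`. -/
def chainsAvoiding (x : α) : PreAbstractSimplicialComplex α where
  faces := {c | c.Nonempty ∧ IsChain (· ≤ ·) (c : Set α) ∧ x ∉ c}
  isRelLowerSet_faces := fun _ h => ⟨h.1, fun _ hts ht =>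
    ⟨ht, h.2.1.mono (Finset.coe_subset.2 hts), fun hx => h.2.2 (hts hx)⟩⟩

/-- Let `B` be the set of elements below `x`, or of those above `x`. For dismantlable `s ⊆ B`, the
chains through `x` that meet `B` within `s` can be collapsed away: when `y` is the last point of
`s`, with witness `m` of its irreducibility, the chains that contain `x` and `y` are stable under
inserting and erasing `m`, as `m` is comparable to everything in `s` that is comparable to `y`. -/
theorem collapses_chainsThrough [Finite α] {x : α} {B s : Set α} (hxB : x ∉ B)
    (hB : ∀ z ∉ B, (z ≤ x ∨ x ≤ z) → ∀ y ∈ B, z ≤ y ∨ y ≤ z) (hs : IsDismantlable s)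
    (hsB : s ⊆ B) :
    Relation.ReflTransGen ElementaryCollapse (chainsThrough x B s) (chainsAvoiding x) := by
  classical
  induction hs with
  | singleton y =>
    have hyB : y ∈ B := hsB rfl
    refine collapses_of_cone (Set.toFinite _) y (A := {c ∈ (chainsThrough x B {y}).faces | x ∈ c})
      (Set.sep_subset _ _) (fun c hc d hd hcd => ⟨hd, hcd hc.2⟩) ?_ ?_
    · rintro c ⟨⟨hne, hch, hcB⟩, hxc⟩
      have hxe : x ∈ c.erase y := Finset.mem_erase.2 ⟨fun h => hxB (h ▸ hyB), hxc⟩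
      refine ⟨⟨⟨Finset.insert_nonempty _ _, ?_, ?_⟩, Finset.mem_insert_of_mem hxc⟩,
        ⟨⟨⟨x, hxe⟩, hch.mono (Finset.coe_subset.2 (Finset.erase_subset _ _)),
          fun _ z hz => hcB hxc z (Finset.mem_of_mem_erase hz)⟩, hxe⟩⟩
      · rw [Finset.coe_insert]
        refine hch.insert fun z hz hzy => ?_
        have hzB : z ∉ B := fun h => hzy (hcB hxc z hz h).symm
        exact (hB z hzB (hch.total hz hxc) y hyB).symm
      · intro _ z hz hzB
        rcases Finset.mem_insert.1 hz with rfl | hz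
        · rfl
        · exact hcB hxc z hz hzB
    · ext c
      simp only [chainsAvoiding, chainsThrough, Set.mem_ofPred_eq, Set.mem_sdiff]
      tauto
  | insert s y _ hy hirr ih =>
    have hyB : y ∈ B := hsB (Set.mem_insert _ _)
    have hsB' : s ⊆ B := (Set.subset_insert _ _).trans hsB
    refine Relation.ReflTransGen.trans ?_ (ih hsB')
    obtain ⟨m, hms, hmy, hm⟩ : ∃ m ∈ s, m ≠ y ∧
        ∀ z ∈ insert y s, (z ≤ y ∨ y ≤ z) → m ≤ z ∨ z ≤ m := by
      rcases hirr with ⟨m, ⟨hm, hmy⟩, hb⟩ | ⟨m, ⟨hm, hmy⟩, hb⟩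
      · refine ⟨m, hm.resolve_left hmy.ne, hmy.ne, fun z hz h => ?_⟩
        rcases h with h | h
        · rcases h.eq_or_lt with rfl | h
          · exact .inl hmy.le
          · exact .inr (hb ⟨hz, h⟩)
        · exact .inl (hmy.le.trans h)
      · refine ⟨m, hm.resolve_left hmy.ne', hmy.ne', fun z hz h => ?_⟩
        rcases h with h | h
        · exact .inr (h.trans hmy.le)
        · rcases h.eq_or_lt with rfl | h
          · exact .inr hmy.le
          · exact .inl (hb ⟨hz, h⟩)
    refine collapses_of_cone (Set.toFinite _) m
      (A := {c ∈ (chainsThrough x B (insert y s)).faces | x ∈ c ∧ y ∈ c})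
      (Set.sep_subset _ _) (fun c hc d hd hcd => ⟨hd, hcd hc.2.1, hcd hc.2.2⟩) ?_ ?_
    · rintro c ⟨⟨hne, hch, hcB⟩, hxc, hyc⟩
      have hxe : x ∈ c.erase m := Finset.mem_erase.2 ⟨fun h => hxB (h ▸ hsB' hms), hxc⟩
      have hye : y ∈ c.erase m := Finset.mem_erase.2 ⟨hmy.symm, hyc⟩
      refine ⟨⟨⟨Finset.insert_nonempty _ _, ?_, ?_⟩, Finset.mem_insert_of_mem hxc,
          Finset.mem_insert_of_mem hyc⟩,
        ⟨⟨⟨x, hxe⟩, hch.mono (Finset.coe_subset.2 (Finset.erase_subset _ _)),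
          fun _ z hz => hcB hxc z (Finset.mem_of_mem_erase hz)⟩, hxe, hye⟩⟩
      · rw [Finset.coe_insert]
        refine hch.insert fun z hz _ => ?_
        by_cases hzB : z ∈ B
        · exact hm z (hcB hxc z hz hzB) (hch.total hz hyc)
        · exact (hB z hzB (hch.total hz hxc) m (hsB' hms)).symm
      · intro _ z hz hzB
        rcases Finset.mem_insert.1 hz with rfl | hz
        · exact .inr hms
        · exact hcB hxc z hz hzB
    · ext c
      simp only [chainsThrough, Set.mem_ofPred_eq, Set.mem_sdiff]
      constructor
      · rintro ⟨h1, h2, h3⟩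
        exact ⟨⟨h1, h2, fun hx z hz hzB => .inr (h3 hx z hz hzB)⟩,
          fun h => hy (h3 h.2.1 y h.2.2 hyB)⟩
      · rintro ⟨⟨h1, h2, h3⟩, h4⟩
        refine ⟨h1, h2, fun hx z hz hzB => (h3 hx z hz hzB).resolve_left ?_⟩
        rintro rfl
        exact h4 ⟨⟨h1, h2, h3⟩, hx, hz⟩

theorem IsWeakPoint.collapses [Finite α] {x : α} (hx : IsWeakPoint x) :
    Relation.ReflTransGen ElementaryCollapse (chainComplex α) (chainsAvoiding x) := by
  have h (B : Set α) : chainComplex α = chainsThrough x B B := by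
    refine PreAbstractSimplicialComplex.ext (Set.ext fun c => ?_)
    simp only [chainComplex, chainsThrough, Set.mem_ofPred_eq]
    tauto
  rcases hx with hx | hx
  · rw [h (Set.Iio x)]
    refine collapses_chainsThrough (by simp) (fun z hz hzx y hy => .inr ?_) hx subset_rfl
    have hxz : x ≤ z := hzx.elim (fun h => (not_lt_iff_le_imp_ge.1 hz) h) id
    exact le_of_lt (lt_of_lt_of_le hy hxz)
  · rw [h (Set.Ioi x)]
    refine collapses_chainsThrough (by simp) (fun z hz hzx y hy => .inl ?_) hx subset_rfl
    have hxz : z ≤ x := hzx.elim id (fun h => (not_lt_iff_le_imp_ge.1 hz) h)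
    exact le_of_lt (lt_of_le_of_lt hxz hy)

end WeakPoint

theorem PosetStep.sameSimpleHomotopyType {P Q : FinPartOrd.{u}} (h : PosetStep P Q) :
    SameSimpleHomotopyType (orderComplex P) (orderComplex Q) := by
  obtain ⟨⟨e⟩⟩ | ⟨x, hx, ⟨e⟩⟩ := h
  · exact .of_orderIso e
  have hfin : (chainsAvoiding x).faces.Finite := Set.toFinite _
  let f : Q ↪o P := e.symm.toOrderEmbedding.trans (OrderEmbedding.subtype _)
  have hf (y : P) : y ∈ Set.range f ↔ y ≠ x := by
    refine ⟨?_, fun hy => ⟨e ⟨y, hy⟩, by simp [f]⟩⟩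
    rintro ⟨z, rfl⟩
    exact (e.symm z).2
  have hiso : SimplicialIso (orderComplex Q).complex (chainsAvoiding x) := by
    refine simplicialIso_chainComplex f fun t => ?_
    refine and_congr_right fun _ => and_congr_right fun _ => ?_
    exact ⟨fun h y hy => (hf y).2 fun e => h (e ▸ hy), fun h hx => (hf x).1 (h x hx) rfl⟩
  exact (sameSimpleHomotopyType_of_collapses hx.collapses (orderComplex P).finite_faces hfin).trans
    (SameSimpleHomotopyType.symm (Relation.EqvGen.rel _ _ (.iso (orderComplex Q) ⟨P, _, hfin⟩ hiso)))

/-! ### Barycentric subdivision -/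

section Barycentric

variable {V : Type u} (K : PreAbstractSimplicialComplex V)

/-- The complex that interpolates between `K` and its barycentric subdivision: its simplices are
the sets `s ∪ {t₁ < ⋯ < tₖ}`, where `s` is empty or a face of `K`, the `tᵢ` form a chain of faces
of `K`, and `s` is contained in all of them. -/
def subdivisionCylinder : PreAbstractSimplicialComplex (V ⊕ {s : Finset V // s ∈ K.faces}) where
  faces := {c | c.Nonempty ∧ (c.toLeft.Nonempty → c.toLeft ∈ K.faces) ∧
    (∀ t t', Sum.inr t ∈ c → Sum.inr t' ∈ c → t ≤ t' ∨ t' ≤ t) ∧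
    ∀ v t, Sum.inl v ∈ c → Sum.inr t ∈ c → v ∈ t.1}
  isRelLowerSet_faces := fun _ h => ⟨h.1, fun _ hdc hd => ⟨hd,
    fun hne => (K.isRelLowerSet_faces (h.2.1 (hne.mono (Finset.toLeft_subset_toLeft hdc)))).2
      (Finset.toLeft_subset_toLeft hdc) hne,
    fun t t' ht ht' => h.2.2.1 t t' (hdc ht) (hdc ht'),
    fun v t hv ht => h.2.2.2 v t (hdc hv) (hdc ht)⟩⟩

/-- The subcomplex of the cylinder without barycentres, a copy of `K`. -/
def cylinderBottom : PreAbstractSimplicialComplex (V ⊕ {s : Finset V // s ∈ K.faces}) where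
  faces := {c ∈ (subdivisionCylinder K).faces | ∀ t, Sum.inr t ∉ c}
  isRelLowerSet_faces := fun _ h => ⟨h.1.1, fun _ hdc hd =>
    ⟨((subdivisionCylinder K).isRelLowerSet_faces h.1).2 hdc hd, fun t ht => h.2 t (hdc ht)⟩⟩

/-- The subcomplex of the cylinder without vertices of `K`, a copy of the barycentric
subdivision. -/
def cylinderTop : PreAbstractSimplicialComplex (V ⊕ {s : Finset V // s ∈ K.faces}) where
  faces := {c ∈ (subdivisionCylinder K).faces | ∀ v, Sum.inl v ∉ c}
  isRelLowerSet_faces := fun _ h => ⟨h.1.1, fun _ hdc hd =>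
    ⟨((subdivisionCylinder K).isRelLowerSet_faces h.1).2 hdc hd, fun t ht => h.2 t (hdc ht)⟩⟩

variable {K}

theorem finite_faces_subdivisionCylinder (hK : K.faces.Finite) :
    (subdivisionCylinder K).faces.Finite := by
  classical
  have : Finite {s : Finset V // s ∈ K.faces} := hK.to_subtype
  have hfin : (((⋃ s ∈ K.faces, (s : Set V)).image Sum.inl) ∪
      Set.range (Sum.inr : _ → V ⊕ {s : Finset V // s ∈ K.faces})).Finite :=
    ((hK.biUnion fun s _ => s.finite_toSet).image _).union (Set.finite_range _)
  refine (Set.Finite.preimage (f := fun c : Finset (V ⊕ {s : Finset V // s ∈ K.faces}) =>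
    (c : Set (V ⊕ {s : Finset V // s ∈ K.faces}))) Finset.coe_injective.injOn
    hfin.finite_subsets).subset fun c hc => ?_
  rintro (v | t) hx
  · have hv : v ∈ c.toLeft := Finset.mem_toLeft.2 hx
    exact .inl ⟨v, Set.mem_biUnion (hc.2.1 ⟨v, hv⟩) hv, rfl⟩
  · exact .inr ⟨t, rfl⟩

/-- The barycentres are removed in increasing order: once the smaller ones are gone, the simplices
that contain the barycentre of `t` are stable under inserting and erasing any vertex of `t`. -/
theorem subdivisionCylinder_collapses_bottom (hK : K.faces.Finite) :
    Relation.ReflTransGen ElementaryCollapse (subdivisionCylinder K) (cylinderBottom K) := by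
  classical
  have : Finite {s : Finset V // s ∈ K.faces} := hK.to_subtype
  have hne (t : {s : Finset V // s ∈ K.faces}) : ∃ v, v ∈ t.1 := (K.isRelLowerSet_faces t.2).1
  choose p hp using hne
  refine collapses_of_patchwork (ι := {s : Finset V // s ∈ K.faces}ᵒᵈ)
    (finite_faces_subdivisionCylinder hK)
    (fun t => {c ∈ (subdivisionCylinder K).faces | Sum.inr (OrderDual.ofDual t) ∈ c ∧
      ∀ t', Sum.inr t' ∈ c → OrderDual.ofDual t ≤ t'})
    (fun t => Sum.inl (p (OrderDual.ofDual t))) (fun t => Set.sep_subset _ _) ?_ ?_ ?_ ?_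
  · exact fun t t' c h h' => le_antisymm (h'.2.2 _ h.2.1) (h.2.2 _ h'.2.1)
  · rintro t c ⟨-, htc, -⟩ d hd hcd
    obtain ⟨m, hm⟩ := d.toRight.exists_minimal ⟨_, Finset.mem_toRight.2 (hcd htc)⟩
    have hmd : Sum.inr m ∈ d := Finset.mem_toRight.1 hm.prop
    have hmin (t' : _) (ht' : Sum.inr t' ∈ d) : m ≤ t' :=
      (hd.2.2.1 m t' hmd ht').elim id fun h => hm.le_of_le (Finset.mem_toRight.2 ht') h
    exact ⟨OrderDual.toDual m, hmin _ (hcd htc), hd, hmd, hmin⟩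
  · intro t c hc
    obtain ⟨⟨hne, hcK, hch, hcs⟩, htc, hmin⟩ := hc
    refine ⟨⟨⟨Finset.insert_nonempty _ _, fun hne => ?_, ?_, ?_⟩, ?_, ?_⟩, ?_⟩
    · refine (K.isRelLowerSet_faces (OrderDual.ofDual t).2).2 (fun v hv => ?_) hne
      rcases Finset.mem_insert.1 (Finset.mem_toLeft.1 hv) with h | h
      · rw [Sum.inl.inj h]; exact hp _
      · exact hcs v _ h htc
    · intro t₁ t₂ h₁ h₂
      exact hch t₁ t₂ (by simpa using h₁) (by simpa using h₂)
    · intro v t₁ hv h₁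
      have h₁ : Sum.inr t₁ ∈ c := by simpa using h₁
      rcases Finset.mem_insert.1 hv with h | h
      · rw [Sum.inl.inj h]; exact hmin t₁ h₁ (hp _)
      · exact hcs v t₁ h h₁
    · simpa using htc
    · intro t' ht'
      exact hmin t' (by simpa using ht')
    · have hte : Sum.inr (OrderDual.ofDual t) ∈ c.erase (Sum.inl (p (OrderDual.ofDual t))) := by
        simpa using htc
      exact ⟨((subdivisionCylinder K).isRelLowerSet_faces ⟨hne, hcK, hch, hcs⟩).2
        (Finset.erase_subset _ _) ⟨_, hte⟩, hte,
        fun t' ht' => hmin t' (Finset.mem_of_mem_erase ht')⟩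
  · ext c
    simp only [cylinderBottom, Set.mem_ofPred_eq, Set.mem_sdiff, Set.mem_iUnion, not_exists]
    refine and_congr_right fun hc => ⟨fun h t ht => h _ ht.2.1, fun h t ht => ?_⟩
    obtain ⟨m, hm⟩ := c.toRight.exists_minimal ⟨_, Finset.mem_toRight.2 ht⟩
    have hmc : Sum.inr m ∈ c := Finset.mem_toRight.1 hm.prop
    exact h (OrderDual.toDual m) ⟨hc, hmc, fun t' ht' =>
      (hc.2.2.1 m t' hmc ht').elim id fun h => hm.le_of_le (Finset.mem_toRight.2 ht') h⟩

/-- The simplices that meet `V` are removed in decreasing order of their intersection `s` with `V`: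
for given `s` they are stable under inserting and erasing the barycentre of `s`. -/
theorem subdivisionCylinder_collapses_top (hK : K.faces.Finite) :
    Relation.ReflTransGen ElementaryCollapse (subdivisionCylinder K) (cylinderTop K) := by
  classical
  have : Finite {s : Finset V // s ∈ K.faces} := hK.to_subtype
  refine collapses_of_patchwork (ι := {s : Finset V // s ∈ K.faces})
    (finite_faces_subdivisionCylinder hK)
    (fun s => {c ∈ (subdivisionCylinder K).faces | c.toLeft = s.1})
    (fun s => Sum.inr s) (fun s => Set.sep_subset _ _) ?_ ?_ ?_ ?_
  · exact fun s s' c h h' => Subtype.ext (h.2.symm.trans h'.2)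
  · rintro s c ⟨-, hcs⟩ d hd hcd
    have hsub : s.1 ⊆ d.toLeft := hcs ▸ Finset.toLeft_subset_toLeft hcd
    exact ⟨⟨d.toLeft, hd.2.1 ((K.isRelLowerSet_faces s.2).1.mono hsub)⟩, hsub, hd, rfl⟩
  · intro s c hc
    obtain ⟨⟨hne, hcK, hch, hcs⟩, hl⟩ := hc
    have hl₁ : (insert (Sum.inr s) c).toLeft = s.1 := by
      rw [← hl]; ext v; simp
    have hl₂ : (c.erase (Sum.inr s)).toLeft = s.1 := by
      rw [← hl]; ext v; simp
    have hmem (v : V) (hv : v ∈ s.1) : Sum.inl v ∈ c := by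
      rw [← hl] at hv; exact Finset.mem_toLeft.1 hv
    have hmem' (v : V) (hv : Sum.inl v ∈ c) : v ∈ s.1 := by
      rw [← hl]; exact Finset.mem_toLeft.2 hv
    have hle (t) (ht : Sum.inr t ∈ c) : s ≤ t := fun v hv => hcs v t (hmem v hv) ht
    refine ⟨⟨⟨Finset.insert_nonempty _ _, fun _ => hl₁ ▸ s.2, ?_, ?_⟩, hl₁⟩,
      ⟨((subdivisionCylinder K).isRelLowerSet_faces ⟨hne, hcK, hch, hcs⟩).2
        (Finset.erase_subset _ _) ?_, hl₂⟩⟩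
    · intro t₁ t₂ h₁ h₂
      rcases Finset.mem_insert.1 h₁ with h₁ | h₁ <;> rcases Finset.mem_insert.1 h₂ with h₂ | h₂
      · rw [Sum.inr.inj h₁, Sum.inr.inj h₂]; exact .inl le_rfl
      · rw [Sum.inr.inj h₁]; exact .inl (hle _ h₂)
      · rw [Sum.inr.inj h₂]; exact .inr (hle _ h₁)
      · exact hch t₁ t₂ h₁ h₂
    · intro v t hv ht
      have hv : Sum.inl v ∈ c := by simpa using hv
      rcases Finset.mem_insert.1 ht with h | h
      · rw [Sum.inr.inj h]; exact hmem' v hv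
      · exact hcs v t hv h
    · obtain ⟨v, hv⟩ := (K.isRelLowerSet_faces s.2).1
      exact ⟨Sum.inl v, by simpa using hmem v hv⟩
  · ext c
    simp only [cylinderTop, Set.mem_ofPred_eq, Set.mem_sdiff, Set.mem_iUnion, not_exists]
    refine and_congr_right fun hc => ⟨fun h s hs => ?_, fun h v hv => ?_⟩
    · obtain ⟨v, hv⟩ := (K.isRelLowerSet_faces s.2).1
      rw [← hs.2] at hv
      exact h v (Finset.mem_toLeft.1 hv)
    · exact h ⟨c.toLeft, hc.2.1 ⟨v, Finset.mem_toLeft.2 hv⟩⟩ ⟨hc, rfl⟩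

theorem simplicialIso_cylinderBottom : SimplicialIso K (cylinderBottom K) := by
  refine simplicialIso_of_embedding .inl fun t => ?_
  constructor
  · rintro ⟨⟨⟨x, hx⟩, htK, -, -⟩, hr⟩
    rcases x with v | s
    · refine ⟨t.toLeft, htK ⟨v, Finset.mem_toLeft.2 hx⟩, ?_⟩
      ext (w | s)
      · simp
      · simpa using hr s
    · exact absurd hx (hr s)
  · rintro ⟨s, hs, rfl⟩
    have hl : (s.map (.inl : V ↪ V ⊕ {s : Finset V // s ∈ K.faces})).toLeft = s := by
      ext v; simp
    refine ⟨⟨(K.isRelLowerSet_faces hs).1.map, fun _ => hl.symm ▸ hs, ?_, ?_⟩, ?_⟩ <;> simp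

theorem simplicialIso_cylinderTop :
    SimplicialIso (chainComplex {s : Finset V // s ∈ K.faces}) (cylinderTop K) := by
  refine simplicialIso_of_embedding .inr fun t => ?_
  constructor
  · rintro ⟨⟨⟨x, hx⟩, -, hch, -⟩, hl⟩
    rcases x with v | s
    · exact absurd hx (hl v)
    · refine ⟨t.toRight, ⟨⟨s, Finset.mem_toRight.2 hx⟩, fun a ha b hb _ =>
        hch a b (Finset.mem_toRight.1 ha) (Finset.mem_toRight.1 hb)⟩, ?_⟩
      ext (w | s)
      · simpa using hl w
      · simp
  · rintro ⟨s, ⟨hne, hch⟩, rfl⟩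
    refine ⟨⟨hne.map, ?_, fun a b ha hb => ?_, ?_⟩, ?_⟩
    · rintro ⟨v, hv⟩
      simp at hv
    · exact hch.total (by simpa using ha) (by simpa using hb)
    · simp
    · simp

end Barycentric

theorem sameSimpleHomotopyType_orderComplex_facePoset (K : FinSimplicialComplex.{u}) :
    SameSimpleHomotopyType K (orderComplex (facePoset K)) := by
  have hfin := finite_faces_subdivisionCylinder K.finite_faces
  have hb : (cylinderBottom K.complex).faces.Finite := hfin.subset (Set.sep_subset _ _)
  have ht : (cylinderTop K.complex).faces.Finite := hfin.subset (Set.sep_subset _ _)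
  have h1 : SameSimpleHomotopyType K ⟨_, cylinderBottom K.complex, hb⟩ :=
    Relation.EqvGen.rel _ _ (.iso _ _ simplicialIso_cylinderBottom)
  have h2 : SameSimpleHomotopyType (orderComplex (facePoset K))
      ⟨_, cylinderTop K.complex, ht⟩ :=
    Relation.EqvGen.rel _ _ (.iso _ _ simplicialIso_cylinderTop)
  exact h1.trans ((sameSimpleHomotopyType_of_collapses
    (subdivisionCylinder_collapses_bottom K.finite_faces) hfin hb).symm.trans
    ((sameSimpleHomotopyType_of_collapses
      (subdivisionCylinder_collapses_top K.finite_faces) hfin ht).trans h2.symm))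

/-! ### The correspondence -/

theorem SimplyEquivalent.sameSimpleHomotopyType {P Q : FinPartOrd.{u}} (h : SimplyEquivalent P Q) :
    SameSimpleHomotopyType (orderComplex P) (orderComplex Q) := by
  induction h with
  | rel _ _ h => exact h.sameSimpleHomotopyType
  | refl _ => exact Relation.EqvGen.refl _
  | symm _ _ _ ih => exact ih.symm
  | trans _ _ _ _ _ ih ih' => exact ih.trans ih'

theorem SameSimpleHomotopyType.simplyEquivalent {K L : FinSimplicialComplex.{u}}
    (h : SameSimpleHomotopyType K L) : SimplyEquivalent (facePoset K) (facePoset L) := by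
  induction h with
  | rel _ _ h =>
    cases h with
    | iso _ _ h => exact h.simplyEquivalent
    | collapse V K L hK hL h => exact h.simplyEquivalent hK hL
  | refl _ => exact .refl _
  | symm _ _ _ ih => exact ih.symm
  | trans _ _ _ _ _ ih ih' => exact ih.trans ih'

theorem theorem3p7 :
    (∀ P Q : FinPartOrd.{u},
      SimplyEquivalent P Q ↔ SameSimpleHomotopyType (orderComplex P) (orderComplex Q)) ∧
    (∀ K L : FinSimplicialComplex.{v},
      SameSimpleHomotopyType K L ↔ SimplyEquivalent (facePoset K) (facePoset L)) := by
  refine ⟨fun P Q => ⟨fun h => h.sameSimpleHomotopyType, fun h => ?_⟩,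
    fun K L => ⟨fun h => h.simplyEquivalent, fun h => ?_⟩⟩
  · exact (simplyEquivalent_facePoset_orderComplex P).symm.trans
      (h.simplyEquivalent.trans (simplyEquivalent_facePoset_orderComplex Q))
  · exact (sameSimpleHomotopyType_orderComplex_facePoset K).trans
      (h.sameSimpleHomotopyType.trans (sameSimpleHomotopyType_orderComplex_facePoset L).symm)
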